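/- Let $p_1\neq p_2$ be primes. For an abelian group $G$ and a prime $p$ put $p^\omega G=\bigcap_{n\ge 0}p^nG$. For an infinite cardinal $\kappa$ let $\mathbf K_2(\kappa)=(K_2(\kappa),\le_{\mathbf K_2})$, where $K_2(\kappa)$ is the class of torsion-free abelian groups $G$ with $|p_1^\omega G|\le\kappa$ and $|p_2^\omega G|\le\kappa$, and where, for $G,H\in K_2(\kappa)$, $G\le_{\mathbf K_2}H$ means that $G$ is a pure subgroup of $H$ (that is, $nG=G\cap nH$ for all $n\in\mathbb Z$), that $p_1^\omega G=p_1^\omega H$, and that $p_2^\omega G=p_1^\omega G$ or $p_2^\omega G=p_2^\omega H$. Write $\mathbf K=(K,\le_{\mathbf K})$ for such a class. A $\mathbf K$-embedding is an injective homomorphism $f:M\to N$ between members of $K$ with $f[M]\le_{\mathbf K}N$. For $N_1,N_2\in K$, a set $A\subseteq N_1\cap N_2$ of common elements, $b_1\in N_1$ and $b_2\in N_2$, the triples $(b_1,A,N_1)$ and $(b_2,A,N_2)$ are related by $E_{at}$ if there are $N\in K$ and $\mathbf K$-embeddings $f_i:N_i\to N$ that agree on $A$ and satisfy $f_1(b_1)=f_2(b_2)$.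 Let $E$ be the transitive closure of $E_{at}$. The Galois type $\mathbf{gtp}(b/A;N)$ is the $E$-class of $(b,A,N)$; for $M\in K$, $\mathbf{gS}(M)$ is the set of all $\mathbf{gtp}(b/M;N)$ with $M\le_{\mathbf K}N$ and $b\in N$; and for $B\subseteq M$, $\mathbf{gtp}(b/M;N)\upharpoonright B=\mathbf{gtp}(b/B;N)$. For infinite cardinals $\lambda,\theta$, $\mathbf K$ is $(<\lambda,\theta)$-tame if for every $M\in K$ with $|M|=\theta$ and all $p\ne q$ in $\mathbf{gS}(M)$ there is $B\subseteq M$ with $|B|<\lambda$ and $p\upharpoonright B\neq q\upharpoonright B$. Let $\mu$ be a regular uncountable cardinal that is smaller than every measurable cardinal (a measurable cardinal being an uncountable cardinal $\kappa$ such that there is a nonprincipal $\kappa$-complete ultrafilter on $\kappa$). Then for every cardinal $\theta\ge 2^\mu$, $\mathbf K_2(2^\mu)$ is not $(<\mu,\theta)$-tame. -/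

import Mathlib

open Cardinal

universe u

/-! ### Abelian groups -/

/-- `p^ω G`, the subgroup of those `g ∈ G` that are divisible by `p ^ n` in `G` for every `n`. -/
def pOmega (p : ℕ) (G : Type u) [AddCommGroup G] : AddSubgroup G :=
  ⨅ n : ℕ, (nsmulAddMonoidHom (p ^ n) : G →+ G).range

theorem mem_pOmega {p : ℕ} {G : Type u} [AddCommGroup G] {g : G} :
    g ∈ pOmega p G ↔ ∀ n : ℕ, ∃ h : G, p ^ n • h = g := by
  simp [pOmega, AddSubgroup.mem_iInf]

/-- For a subgroup `G` of `H`, the group `p^ω G` (divisibility is computed inside `G`),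
regarded as a subgroup of `H`. -/
def pOmegaSub (p : ℕ) {H : Type u} [AddCommGroup H] (G : AddSubgroup H) : AddSubgroup H :=
  (pOmega p G).map G.subtype

/-- `G` is a pure subgroup of `H`: `n G = G ∩ n H` for every integer `n`. -/
def IsPureSubgroup {H : Type u} [AddCommGroup H] (G : AddSubgroup H) : Prop :=
  ∀ n : ℤ, {x : H | ∃ g ∈ G, n • g = x} = (G : Set H) ∩ {x : H | ∃ h : H, n • h = x}

/-! ### Classes of abelian groups with a strong subgroup relation, and Galois types -/

/-- A pair `𝐊 = (K, ≤_𝐊)` consisting of a class `K` of abelian groups and a relation `≤_𝐊`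
between subgroups of a group and the group. These are the data of an abstract elementary class
in the language of abelian groups; Galois types and tameness are defined from
these data alone. -/
structure GroupClass where
  /-- `Mem G` says that `G ∈ K`. -/
  Mem : ∀ (G : Type u) [AddCommGroup G], Prop
  /-- For a subgroup `G` of `H`, `Le G` says that `G ≤_𝐊 H`. -/
  Le : ∀ {H : Type u} [AddCommGroup H], AddSubgroup H → Prop

namespace GroupClass

/-- `f : M → N` is a `𝐊`-embedding: an isomorphism onto its image `f[M]`, where
`f[M] ≤_𝐊 N`. -/
def IsEmbedding (K : GroupClass.{u}) {M N : Type u} [AddCommGroup M] [AddCommGroup N]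
    (f : M →+ N) : Prop :=
  Function.Injective f ∧ K.Le f.range

/-- A triple `(b, A, N)` with `N ∈ K`, `A ⊆ |N|` and `b ∈ N`. The set of parameters is a fixed
type `A`, and the inclusion `A ⊆ |N|` is an injection of `A` into `N`. -/
structure Triple (K : GroupClass.{u}) (A : Type u) where
  /-- The group `N`. -/
  N : Type u
  [grp : AddCommGroup N]
  mem : K.Mem N
  /-- The inclusion of the parameter set in `N`. -/
  incl : A ↪ N
  /-- The element `b`. -/
  b : N

attribute [instance] Triple.grp

variable {K : GroupClass.{u}} {A : Type u}

/-- The relation `E_at` between triples over the same parameter set `A`: both groups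
`𝐊`-embed into some `N ∈ K` in such a way that the embeddings agree on `A` and
send the two distinguished elements to the same element. -/
def EAt (s t : Triple K A) : Prop :=
  ∃ (N : Type u) (_ : AddCommGroup N) (f : s.N →+ N) (g : t.N →+ N),
    K.Mem N ∧ K.IsEmbedding f ∧ K.IsEmbedding g ∧
      (∀ a : A, f (s.incl a) = g (t.incl a)) ∧ f s.b = g t.b

/-- The relation `E`: the transitive closure of `E_at`. -/
def E : Triple K A → Triple K A → Prop :=
  Relation.TransGen EAt

/-- The Galois type `gtp(b / A; N)`: the `E`-class of the triple `(b, A, N)`. -/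
def gtp (t : Triple K A) : Set (Triple K A) :=
  {s | E t s}

/-- The triple `(b, B, N)` obtained from `(b, A, N)` for `B ⊆ A`. -/
def Triple.restrict (t : Triple K A) (B : Set A) : Triple K B where
  N := t.N
  mem := t.mem
  incl := (Function.Embedding.subtype (· ∈ B)).trans t.incl
  b := t.b

/-- The restriction `p ↾ B` of a Galois type `p = gtp(b / A; N)` to `B ⊆ A`, that is,
`gtp(b / B; N)`. It is written as the set of the triples that are `E`-equivalent to `(b, B, N)`
for some representative `(b, A, N)` of `p`; see `restrictType_gtp`. -/
def restrictType (p : Set (Triple K A)) (B : Set A) : Set (Triple K B) :=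
  {s | ∃ t ∈ p, E (t.restrict B) s}

theorem E.restrict {s t : Triple K A} (h : E s t) (B : Set A) :
    E (s.restrict B) (t.restrict B) := by
  refine Relation.TransGen.lift (p := EAt) (fun t : Triple K A => t.restrict B) ?_ _ _ h
  rintro s t ⟨N, i, f, g, hN, hf, hg, hA, hb⟩
  exact ⟨N, i, f, g, hN, hf, hg, fun a => hA a, hb⟩

/-- When `≤_𝐊` is reflexive, restriction of Galois types does not depend on representatives. -/
theorem restrictType_gtp
    (hrefl : ∀ (H : Type u) [AddCommGroup H], K.Mem H → K.Le (⊤ : AddSubgroup H))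
    (t : Triple K A) (B : Set A) : restrictType (gtp t) B = gtp (t.restrict B) := by
  ext s
  constructor
  · rintro ⟨t', ht', hs⟩
    exact Relation.TransGen.trans (E.restrict ht' B) hs
  · intro hs
    have hid : K.IsEmbedding (AddMonoidHom.id t.N) := by
      refine ⟨Function.injective_id, ?_⟩
      have h : (AddMonoidHom.id t.N).range = ⊤ :=
        AddMonoidHom.range_eq_top.2 Function.surjective_id
      rw [h]
      exact hrefl t.N t.mem
    exact ⟨t, Relation.TransGen.single
      ⟨t.N, t.grp, AddMonoidHom.id _, AddMonoidHom.id _, t.mem, hid, hid, fun _ => rfl, rfl⟩, hs⟩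

/-- `gS(M)`: the set of the Galois types `gtp(b / M; N)` with `M ≤_𝐊 N` and `b ∈ N`, the
extension `M ≤_𝐊 N` being a `𝐊`-embedding of `M` into `N ∈ K`. -/
def gS (K : GroupClass.{u}) (M : Type u) [AddCommGroup M] : Set (Set (Triple K M)) :=
  {p | ∃ (N : Type u) (_ : AddCommGroup N) (hN : K.Mem N) (f : M →+ N)
    (hf : K.IsEmbedding f) (b : N), p = gtp ⟨N, hN, ⟨f, hf.1⟩, b⟩}

/-- `𝐊` is `(<κ, θ)`-tame: for every `M ∈ K` of cardinality `θ`, any two distinct types in `gS(M)`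
have distinct restrictions to some subset of `M` of cardinality less than `κ`. -/
def IsTame (K : GroupClass.{u}) (κ θ : Cardinal.{u}) : Prop :=
  ∀ (M : Type u) [AddCommGroup M], K.Mem M → #M = θ →
    ∀ p ∈ K.gS M, ∀ q ∈ K.gS M, p ≠ q →
      ∃ B : Set M, #B < κ ∧ restrictType p B ≠ restrictType q B

end GroupClass

/-! ### The class `𝐊₂(p₁, p₂, κ)` -/

/-- `K₂(κ)`: torsion-free abelian groups `G` with `|p₁^ω G| ≤ κ` and `|p₂^ω G| ≤ κ`. -/
def K2Mem (p₁ p₂ : ℕ) (κ : Cardinal.{u}) (G : Type u) [AddCommGroup G] : Prop :=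
  IsAddTorsionFree G ∧ #(pOmega p₁ G) ≤ κ ∧ #(pOmega p₂ G) ≤ κ

/-- The pair `𝐊₂(p₁, p₂, κ)`: `G ≤ H` is strong for groups `G, H ∈ K₂(κ)` when `G` is pure in `H`,
`p₁^ω G = p₁^ω H`, and either `p₂^ω G = p₁^ω G` or `p₂^ω G = p₂^ω H`. -/
def K2 (p₁ p₂ : ℕ) (κ : Cardinal.{u}) : GroupClass.{u} where
  Mem G _ := K2Mem p₁ p₂ κ G
  Le {H} _ G := K2Mem p₁ p₂ κ G ∧ K2Mem p₁ p₂ κ H ∧ IsPureSubgroup G ∧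
    pOmegaSub p₁ G = pOmega p₁ H ∧
    (pOmegaSub p₂ G = pOmegaSub p₁ G ∨ pOmegaSub p₂ G = pOmega p₂ H)

/-! ### Measurable cardinals -/

/-- `κ` is a measurable cardinal: it is uncountable and a set of cardinality `κ` carries
a nonprincipal `κ`-complete ultrafilter. -/
def IsMeasurableCardinal (κ : Cardinal.{u}) : Prop :=
  ℵ₀ < κ ∧ ∃ (X : Type u) (U : Ultrafilter X), #X = κ ∧ (∀ x : X, U ≠ pure x) ∧
    CardinalInterFilter (U : Filter X) κ

/-! Let `#I = μ` and `n = p₁ * p₂`. The group `M` is `smallSupport ⊕ ℤ[1/n] ⊕ ℤ⁽ᴶ⁾`, and `N`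
enlarges the first summand to `mostlyAway`. An element of `mostlyAway` that is divisible by all
powers of `p₁` has small support, so `p₁^ω M = p₁^ω N`. Moreover `p₂^ω M = p₁^ω M`, so `M ≤ N` by
the first alternative, although `p₂^ω N` is larger. The two types are those of `(1, 0, 0)` and `(1,
1, 0)` over `M`, where the first `1` is the constant function.

They agree over every `B` with `#B < μ`: by regularity some coordinate `i` vanishes on all of `B`,
and the automorphism `(z, t, j) ↦ (z, t + z i, j)` of `N` fixes `B` and moves one element to the
other.

They differ over `M`: the elements lie in `p₂^ω` but not in `p₁^ω`, which forces the second
alternative in every amalgam. Equality of types thus yields an endomorphism of `p₂^ω N` that fixes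
`p₂^ω M` and carries one element to the other (`exists_hom_pOmega_of_E`). Its `ℤ[1/n]` component,
restricted to `ℤ ^ I`, kills all unit vectors but not the constant `1`. Since there is no measurable
cardinal up to `μ`, this contradicts Łoś's theorem (`map_one_eq_zero_of_map_single`). -/

/-! ### Measurable cardinals from countably complete ultrafilters -/

section Measurable

open Filter

/-- Take `κ` least such that some map from `I` to a set of size `κ` has all fibres outside `U`, and
push `U` forward. A family of fewer than `κ` large sets with intersection not large would give such
a map to a smaller set: send a point to a member of the family that misses it, or to `none`. -/
theorem exists_isMeasurableCardinal_le {I : Type u} (U : Ultrafilter I)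
    (hU : CountableInterFilter (U : Filter I)) (hpure : ∀ i, U ≠ pure i) :
    ∃ κ : Cardinal.{u}, IsMeasurableCardinal κ ∧ κ ≤ #I := by
  classical
  let P : Set Cardinal.{u} :=
    {κ | ∃ (X : Type u) (f : I → X), #X = κ ∧ ∀ x, f ⁻¹' {x} ∉ U}
  have hI : #I ∈ P := by
    refine ⟨I, id, rfl, fun x hx => hpure x ?_⟩
    exact (Ultrafilter.eq_of_le (f := U) (g := pure x) (by simpa using hx))
  obtain ⟨κ, hκ, hmin⟩ := WellFounded.has_min (wellFounded_lt (α := Cardinal.{u})) P ⟨_, hI⟩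
  have hmin' : ∀ κ' < κ, κ' ∉ P := fun κ' h h' => hmin κ' h' h
  obtain ⟨X, f, hX, hf⟩ := hκ
  have hunc : ℵ₀ < κ := by
    by_contra hle
    have : Countable X := by
      rw [← Cardinal.mk_le_aleph0_iff, hX]; exact not_lt.1 hle
    have h : (⋂ x, (f ⁻¹' {x})ᶜ) ∈ (U : Filter I) :=
      countable_iInter_mem.2 fun x => Ultrafilter.compl_mem_iff_notMem.2 (hf x)
    obtain ⟨i, hi⟩ := U.nonempty_of_mem h
    exact Set.mem_iInter.1 hi (f i) rfl
  refine ⟨κ, ⟨hunc, X, U.map f, hX, ?_, ⟨?_⟩⟩, not_lt.1 fun h => hmin' _ h hI⟩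
  · intro x hx
    have : ({x} : Set X) ∈ U.map f := by rw [hx]; exact rfl
    exact hf x this
  · intro S hS hmem
    by_contra hnot
    have hex : ∀ x, ∃ o : Option S, (o = none → x ∈ ⋂₀ S) ∧ ∀ s : S, o = some s → x ∉ s.1 := by
      intro x
      by_cases hx : ∃ s : S, x ∉ s.1
      · obtain ⟨s, hs⟩ := hx
        exact ⟨some s, by simp, by rintro t ⟨⟩; exact hs⟩
      · push Not at hx
        exact ⟨none, fun _ s hs => hx ⟨s, hs⟩, by simp⟩
    choose g hg hg' using hex
    refine hmin' #(Option S) ?_ ⟨Option S, g ∘ f, rfl, ?_⟩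
    · rw [Cardinal.mk_option]
      exact Cardinal.add_lt_of_lt hunc.le hS (one_lt_aleph0.trans hunc)
    · rintro (_ | s) h
      · exact hnot (mem_of_superset (x := g ⁻¹' {none}) h fun x hx => hg x hx)
      · obtain ⟨x, hx, hx'⟩ := (U.map f).nonempty_of_mem
          (inter_mem (show g ⁻¹' {some s} ∈ (U.map f : Filter X) from h) (hmem s.1 s.2))
        exact hg' x s hx hx'

end Measurable

/-! ### Homomorphisms from `ℤ ^ I` to countable slender groups -/

section Slender

variable {I : Type*} {A : Type*} [AddCommGroup A]

/-- For a hom `h` from `ℤ ^ I` to a countable reduced torsion-free group, every pointwise eventually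
vanishing sequence in `ℤ ^ I` has a term in the kernel. -/
theorem exists_map_eq_zero_of_eventually_zero [Countable A] [IsAddTorsionFree A]
    (hA : ∀ a : A, a ≠ 0 → ∃ m : ℤ, m ≠ 0 ∧ ∀ b : A, m • b ≠ a)
    (h : (I → ℤ) →+ A) (y : ℕ → I → ℤ) (hy : ∀ i, ∃ N, ∀ n ≥ N, y n i = 0) :
    ∃ n, h (y n) = 0 := by
  classical
  by_contra! hne
  choose m hm0 hm using fun n => hA _ (hne n)
  choose N hN using hy
  let c : ℕ → ℤ := fun n => ∏ k ∈ Finset.range n, m k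
  have hc0 : ∀ n, c n ≠ 0 := fun n => Finset.prod_ne_zero_iff.2 fun k _ => hm0 k
  have hcdvd : ∀ {a b}, a ≤ b → c a ∣ c b := fun hab =>
    Finset.prod_dvd_prod_of_subset _ _ _ (Finset.range_mono hab)
  let e : Set ℕ → ℕ → ℤ := fun S n => if n ∈ S then 1 else 0
  -- This is the formal sum of `c k • y k` over `k ∈ S`, finite at each coordinate. If `S` and `T`
  -- first differ at `n`, then `x S` and `x T` differ by `± c n • y n` modulo `c (n + 1)`. Equal
  -- values under `h` would make `m n` divide `h (y n)`. So `2 ^ ℵ₀` many values are distinct in the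
  -- countable `A`.
  let x : Set ℕ → I → ℤ := fun S i => ∑ k ∈ Finset.range (N i), e S k * c k * y k i
  have key : ∀ S T : Set ℕ, ∀ n, n ∈ S → n ∉ T → (∀ k < n, (k ∈ S ↔ k ∈ T)) →
      h (x S) ≠ h (x T) := by
    intro S T n hS hT hlt heq
    have hdiv : ∀ i, c (n + 1) ∣ x S i - x T i - c n * y n i := by
      intro i
      have h1 : c n * y n i =
          ∑ k ∈ Finset.range (N i), if k = n then c k * y k i else 0 := by
        rw [Finset.sum_ite_eq' (Finset.range (N i)) n]
        split_ifs with hn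
        · rfl
        · rw [hN i n (by simpa using hn), mul_zero]
      rw [h1, ← Finset.sum_sub_distrib, ← Finset.sum_sub_distrib]
      refine Finset.dvd_sum fun k _ => ?_
      rcases lt_trichotomy k n with hk | rfl | hk
      · have : e S k = e T k := by simp only [e, hlt k hk]
        simp [this, hk.ne]
      · simp [e, hS, hT]
      · rw [if_neg hk.ne', sub_zero]
        exact dvd_sub (((hcdvd hk).mul_left _).mul_right _) (((hcdvd hk).mul_left _).mul_right _)
    choose z hz using hdiv
    have hxz : x S - x T = c n • y n + c (n + 1) • z := by
      ext i
      have := hz i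
      simp only [Pi.sub_apply, Pi.add_apply, Pi.smul_apply, smul_eq_mul]
      linarith
    have h2 : c n • (h (y n) + m n • h z) = 0 := by
      have h3 := congrArg h hxz
      rw [map_sub, heq, sub_self, map_add, map_zsmul, map_zsmul] at h3
      rw [smul_add, smul_smul, h3]
      simp [c, Finset.prod_range_succ]
    have h4 : h (y n) + m n • h z = 0 := by
      rcases smul_eq_zero.1 h2 with h5 | h5
      · exact absurd h5 (hc0 n)
      · exact h5
    exact hm n (-h z) (by rw [smul_neg]; exact (eq_neg_of_add_eq_zero_left h4).symm)
  have hinj : Function.Injective fun S : Set ℕ => h (x S) := by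
    intro S T heq
    by_contra hST
    have hex : ∃ n, ¬ (n ∈ S ↔ n ∈ T) := by
      by_contra! hall
      exact hST (Set.ext hall)
    have hmin : ∀ k < Nat.find hex, (k ∈ S ↔ k ∈ T) := fun k hk => not_not.1 (Nat.find_min hex hk)
    have hsp := Nat.find_spec hex
    by_cases hS : Nat.find hex ∈ S
    · exact key S T _ hS (fun hT => hsp (by simp [hS, hT])) hmin heq
    · have hT : Nat.find hex ∈ T := by
        by_contra hT
        exact hsp (by simp [hS, hT])
      exact key T S _ hT hS (fun k hk => (hmin k hk).symm) heq.symm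
  have hcount : Countable (Set ℕ) := hinj.countable
  obtain ⟨g, hg⟩ := exists_injective_nat (Set ℕ)
  exact Function.cantor_injective g hg

/-- **Łoś's theorem**: if every countably complete ultrafilter on `I` is principal, then a hom from
`ℤ ^ I` to a countable reduced torsion-free group is zero as soon as it kills the unit vectors. -/
theorem map_one_eq_zero_of_map_single [Countable A] [IsAddTorsionFree A] [DecidableEq I]
    (hA : ∀ a : A, a ≠ 0 → ∃ m : ℤ, m ≠ 0 ∧ ∀ b : A, m • b ≠ a)
    (hI : ∀ U : Ultrafilter I, CountableInterFilter (U : Filter I) → ∃ i, U = pure i)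
    (h : (I → ℤ) →+ A) (h0 : ∀ i, h (Pi.single i 1) = 0) : h 1 = 0 := by
  classical
  let χ : Set I → I → ℤ := fun S => S.indicator 1
  -- These sets form a σ-ideal. The aim is a non-null set that is not a union of two disjoint
  -- non-null sets, since the ideal then induces a countably complete ultrafilter.
  let null : Set I → Prop := fun S => ∀ T ⊆ S, h (χ T) = 0
  have null_mono : ∀ {S T}, S ⊆ T → null T → null S := fun hST hT V hV => hT V (hV.trans hST)
  have χ_split : ∀ T B : Set I, h (χ T) = h (χ (T ∩ B)) + h (χ (T \ B)) := by
    intro T B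
    rw [← map_add]
    congr 1
    ext i
    by_cases hT : i ∈ T <;> by_cases hB : i ∈ B <;> simp [χ, hT, hB]
  have χ_empty : h (χ ∅) = 0 := by
    rw [← map_zero h]
    exact congrArg h (Set.indicator_empty' _)
  have null_empty : null ∅ := by
    intro T hT
    rwa [Set.subset_empty_iff.1 hT]
  have null_union : ∀ {S T}, null S → null T → null (S ∪ T) := by
    intro S T hS hT V hV
    rw [χ_split V S, hS _ Set.inter_subset_right, hT, add_zero]
    rintro i ⟨hi, hi'⟩
    exact (hV hi).resolve_left hi'
  have null_iUnion : ∀ S : ℕ → Set I, (∀ n, null (S n)) → null (⋃ n, S n) := by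
    intro S hS T hT
    let F : ℕ → Set I := fun n => ⋃ k ∈ Finset.range n, S k
    have hF : ∀ n, null (F n) := by
      intro n
      induction n with
      | zero => simpa [F] using null_empty
      | succ n ih =>
        have : F (n + 1) = S n ∪ F n := by
          simp only [F, Finset.range_add_one, Finset.set_biUnion_insert]
        rw [this]
        exact null_union (hS n) ih
    -- The sets `T \ F n` decrease to `∅`, so one of their indicators is killed; the rest of `T`
    -- lies in the null set `F n`.
    obtain ⟨n, hn⟩ := exists_map_eq_zero_of_eventually_zero hA h (fun n => χ (T \ F n)) <| by
      intro i
      by_cases hi : i ∈ T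
      · obtain ⟨k, hk⟩ := Set.mem_iUnion.1 (hT hi)
        refine ⟨k + 1, fun n hn => Set.indicator_of_notMem (fun hi' => hi'.2 ?_) _⟩
        exact Set.mem_biUnion (by simp; omega) hk
      · exact ⟨0, fun n _ => Set.indicator_of_notMem (fun hi' => hi hi'.1) _⟩
    rw [χ_split T (F n), hF n _ Set.inter_subset_right, hn, add_zero]
  by_contra hne
  have huniv : ¬ null Set.univ := by
    intro hn
    refine hne ?_
    have := hn Set.univ subset_rfl
    simpa [χ] using this
  obtain ⟨S, hS, hprime⟩ : ∃ S, ¬ null S ∧ ∀ T ⊆ S, null T ∨ null (S \ T) := by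
    -- Endless splitting would produce pairwise disjoint `T n` whose indicators all survive `h`;
    -- disjointness makes the indicators eventually zero at each point.
    by_contra! hsplit
    choose f hfsub hf1 hf2 using hsplit
    let s : ℕ → {S // ¬ null S} := fun n =>
      Nat.rec ⟨Set.univ, huniv⟩ (fun _ S => ⟨f S.1 S.2, hf1 S.1 S.2⟩) n
    have hs : ∀ n, (s (n + 1)).1 = f (s n).1 (s n).2 := fun n => rfl
    have hanti : Antitone fun n => (s n).1 := antitone_nat_of_succ_le fun n => hfsub _ _
    have hd : ∀ n, ∃ T ⊆ (s n).1 \ (s (n + 1)).1, h (χ T) ≠ 0 := by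
      intro n
      have := hf2 (s n).1 (s n).2
      rw [← hs] at this
      simpa only [null, not_forall, exists_prop] using this
    choose T hT hTne using hd
    obtain ⟨n, hn⟩ := exists_map_eq_zero_of_eventually_zero hA h (fun n => χ (T n)) <| by
      intro i
      by_cases hi : ∃ k, i ∈ T k
      · obtain ⟨k, hk⟩ := hi
        refine ⟨k + 1, fun n hn => Set.indicator_of_notMem (fun hi' => ?_) _⟩
        exact (hT k hk).2 (hanti hn (hT n hi').1)
      · push Not at hi
        exact ⟨0, fun n _ => Set.indicator_of_notMem (hi n) _⟩
    exact hTne n hn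
  let F : Filter I :=
    { sets := {T | null (S \ T)}
      univ_sets := by simpa using null_empty
      sets_of_superset := fun hT hTV => null_mono (Set.sdiff_subset_sdiff_right hTV) hT
      inter_sets := fun {T V} hT hV => by
        rw [Set.mem_ofPred_eq, Set.sdiff_inter]
        exact null_union hT hV }
  have memF : ∀ T, T ∈ F ↔ null (S \ T) := fun T => Iff.rfl
  let U : Ultrafilter I := Ultrafilter.ofComplNotMemIff F fun T => by
    rw [memF, memF, Set.sdiff_compl]
    constructor
    · intro hn
      have := (hprime (S ∩ T) Set.inter_subset_left).resolve_left hn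
      rwa [Set.sdiff_self_inter] at this
    · intro h1 h2
      refine hS ?_
      rw [← Set.inter_union_sdiff S T]
      exact null_union h2 h1
  have hU : CountableInterFilter (U : Filter I) := by
    refine ⟨fun C hC hmem => ?_⟩
    rcases C.eq_empty_or_nonempty with rfl | hne
    · simp
    · obtain ⟨g, rfl⟩ := hC.exists_eq_range hne
      have : null (⋃ n, S \ g n) := null_iUnion _ fun n => hmem _ ⟨n, rfl⟩
      rwa [← Set.sdiff_iInter, ← Set.sInter_range] at this
  obtain ⟨i, hi⟩ := hI U hU
  have hmem : ({i} : Set I) ∈ U := by rw [hi]; exact rfl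
  have hsing : null {i} := by
    intro T hT
    rcases Set.subset_singleton_iff_eq.1 hT with rfl | rfl
    · exact χ_empty
    · have : χ {i} = Pi.single i 1 := by
        ext j
        by_cases hj : j = i
        · subst hj; simp [χ]
        · simp [χ, hj]
      rw [this, h0]
  exact hS (null_mono (fun j hj => by
    by_cases hji : j ∈ ({i} : Set I)
    · exact Or.inl hji
    · exact Or.inr ⟨hj, hji⟩) (null_union hsing hmem))

end Slender

/-! ### The groups of the counterexample -/

section Rationals

/-- The subgroup `ℤ[1/n]` of `ℚ`. -/
def ratAway (n : ℕ) : AddSubgroup ℚ where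
  carrier := {x | ∃ (k : ℕ) (z : ℤ), (n : ℚ) ^ k * x = z}
  zero_mem' := ⟨0, 0, by simp⟩
  add_mem' := by
    rintro x y ⟨k, z, hz⟩ ⟨l, w, hw⟩
    refine ⟨k + l, n ^ l * z + n ^ k * w, ?_⟩
    push_cast
    rw [← hz, ← hw]
    ring
  neg_mem' := by
    rintro x ⟨k, z, hz⟩
    exact ⟨k, -z, by push_cast; rw [← hz]; ring⟩

theorem intCast_mem_ratAway (n : ℕ) (z : ℤ) : (z : ℚ) ∈ ratAway n := ⟨0, z, by simp⟩

theorem div_pow_mem_ratAway {p n : ℕ} (h : p ∣ n) (hn : n ≠ 0) {x : ℚ} (hx : x ∈ ratAway n)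
    (a : ℕ) : x / (p : ℚ) ^ a ∈ ratAway n := by
  obtain ⟨k, z, hz⟩ := hx
  obtain ⟨d, rfl⟩ := h
  have hp : (p : ℚ) ≠ 0 := by
    rintro h0
    exact hn (by simp [Nat.cast_eq_zero.1 h0])
  refine ⟨k + a, d ^ a * z, ?_⟩
  push_cast at hz ⊢
  rw [← hz]
  field_simp
  ring

/-- An element of `ℤ[1/n]` divisible by all powers of a prime not dividing `n` is zero. -/
theorem eq_zero_of_forall_pow_mul_ratAway {q n : ℕ} (hq : q.Prime) (h : ¬ q ∣ n) {x : ℚ}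
    (hx : x ∈ ratAway n) (hdiv : ∀ a : ℕ, ∃ y ∈ ratAway n, (q : ℚ) ^ a * y = x) : x = 0 := by
  obtain ⟨k, z, hz⟩ := hx
  have hn : (n : ℚ) ≠ 0 := by
    rintro h0
    exact h (by simp [Nat.cast_eq_zero.1 h0])
  have hz0 : z = 0 := by
    have hall : ∀ a : ℕ, (q : ℤ) ^ a ∣ z := by
      intro a
      obtain ⟨y, ⟨l, w, hw⟩, hy⟩ := hdiv a
      have heq : (n : ℤ) ^ l * z = q ^ a * (n ^ k * w) := by
        have : (n : ℚ) ^ l * z = q ^ a * (n ^ k * w) := by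
          rw [← hz, ← hw, ← hy]
          ring
        exact_mod_cast this
      have hcop : IsCoprime ((q : ℤ) ^ a) ((n : ℤ) ^ l) :=
        (Nat.isCoprime_iff_coprime.2 ((Nat.Prime.coprime_iff_not_dvd hq).2 h)).pow
      exact hcop.dvd_of_dvd_mul_left ⟨_, heq⟩
    -- The exponent `|z|` suffices because `q ^ |z| > |z|`.
    refine Int.eq_zero_of_abs_lt_dvd (hall z.natAbs) ?_
    rw [Int.abs_eq_natAbs]
    exact_mod_cast Nat.lt_pow_self hq.one_lt
  rw [hz0, Int.cast_zero] at hz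
  exact (mul_eq_zero.1 hz).resolve_left (pow_ne_zero _ hn)

/-- `ℤ[1/n]` is reduced when `n ≠ 0`. -/
theorem exists_zsmul_ne_of_ratAway {n : ℕ} (hn : n ≠ 0) (a : ratAway n) (ha : a ≠ 0) :
    ∃ m : ℤ, m ≠ 0 ∧ ∀ b : ratAway n, m • b ≠ a := by
  -- A prime above `n` does not divide `n`, so no nonzero element is divisible by all its powers.
  obtain ⟨q, hqn, hq⟩ := Nat.exists_infinite_primes (n + 1)
  by_contra! hall
  refine ha (Subtype.ext (eq_zero_of_forall_pow_mul_ratAway hq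
    (fun h => by have := Nat.le_of_dvd (Nat.pos_of_ne_zero hn) h; omega) a.2 fun k => ?_))
  obtain ⟨b, hb⟩ := hall ((q : ℤ) ^ k) (pow_ne_zero _ (by exact_mod_cast hq.ne_zero))
  refine ⟨b, b.2, ?_⟩
  have := congrArg Subtype.val hb
  simpa using this

end Rationals

/-! ### Function groups with small exceptional sets, and their `p^ω` subgroups. -/

section TestGroups

variable {I : Type u} {μ : Cardinal.{u}}

/-- The functions `I → ℤ[1/n]` with support of cardinality less than `μ`. -/
def smallSupport (I : Type u) (hreg : μ.IsRegular) (n : ℕ) : AddSubgroup (I → ℚ) where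
  carrier := {x | (∀ i, x i ∈ ratAway n) ∧ ∀ᶠ i in Filter.cocardinal I hreg, x i = 0}
  zero_mem' := ⟨fun _ => zero_mem _, Filter.Eventually.of_forall fun _ => rfl⟩
  add_mem' := by
    rintro x y ⟨hx, hx'⟩ ⟨hy, hy'⟩
    refine ⟨fun i => add_mem (hx i) (hy i), ?_⟩
    filter_upwards [hx', hy'] with i h1 h2
    simp [h1, h2]
  neg_mem' := by
    rintro x ⟨hx, hx'⟩
    refine ⟨fun i => neg_mem (hx i), ?_⟩
    filter_upwards [hx'] with i h1
    simp [h1]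

/-- The functions `I → ℤ[1/n]` with values in `ℤ[1/p]` outside of a set of cardinality less
than `μ`. -/
def mostlyAway (I : Type u) (hreg : μ.IsRegular) (n p : ℕ) : AddSubgroup (I → ℚ) where
  carrier := {x | (∀ i, x i ∈ ratAway n) ∧ ∀ᶠ i in Filter.cocardinal I hreg, x i ∈ ratAway p}
  zero_mem' := ⟨fun _ => zero_mem _, Filter.Eventually.of_forall fun _ => zero_mem _⟩
  add_mem' := by
    rintro x y ⟨hx, hx'⟩ ⟨hy, hy'⟩
    refine ⟨fun i => add_mem (hx i) (hy i), ?_⟩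
    filter_upwards [hx', hy'] with i h1 h2
    exact add_mem h1 h2
  neg_mem' := by
    rintro x ⟨hx, hx'⟩
    refine ⟨fun i => neg_mem (hx i), ?_⟩
    filter_upwards [hx'] with i h1
    exact neg_mem h1

theorem smallSupport_le_mostlyAway (hreg : μ.IsRegular) (n p : ℕ) :
    smallSupport I hreg n ≤ mostlyAway I hreg n p := by
  rintro x ⟨hx, hx'⟩
  refine ⟨hx, ?_⟩
  filter_upwards [hx'] with i h1
  rw [h1]
  exact zero_mem _

theorem exists_pow_smul_eq_smallSupport (hreg : μ.IsRegular) {n p : ℕ} (h : p ∣ n) (hn : n ≠ 0)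
    (a : ℕ) (x : smallSupport I hreg n) : ∃ y : smallSupport I hreg n, p ^ a • y = x := by
  have hp : (p : ℚ) ≠ 0 := by
    rintro h0
    exact hn (Nat.eq_zero_of_zero_dvd (by rwa [Nat.cast_eq_zero.1 h0] at h))
  refine ⟨⟨fun i => x.1 i / (p : ℚ) ^ a, fun i => div_pow_mem_ratAway h hn (x.2.1 i) a, ?_⟩, ?_⟩
  · filter_upwards [x.2.2] with i h1
    simp [h1]
  · ext i
    simp
    field_simp

theorem exists_pow_smul_eq_mostlyAway (hreg : μ.IsRegular) {n p : ℕ} (h : p ∣ n) (hn : n ≠ 0)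
    (a : ℕ) (x : mostlyAway I hreg n p) : ∃ y : mostlyAway I hreg n p, p ^ a • y = x := by
  have hp : (p : ℚ) ≠ 0 := by
    rintro h0
    exact hn (Nat.eq_zero_of_zero_dvd (by rwa [Nat.cast_eq_zero.1 h0] at h))
  refine ⟨⟨fun i => x.1 i / (p : ℚ) ^ a, fun i => div_pow_mem_ratAway h hn (x.2.1 i) a, ?_⟩, ?_⟩
  · filter_upwards [x.2.2] with i h1
    exact div_pow_mem_ratAway dvd_rfl (by exact_mod_cast hp) h1 a
  · ext i
    simp
    field_simp

/-- The exceptional sets of `x` and of its countably many quotients have a union of size less than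
`μ`. Off that union, `x i` is divisible by all powers of `q` inside `ℤ[1/p]`, hence zero. -/
theorem mem_smallSupport_of_forall_pow_smul (hreg : μ.IsRegular) (hunc : ℵ₀ < μ) {n p q : ℕ}
    (hq : q.Prime) (hqp : ¬ q ∣ p) (x : mostlyAway I hreg n p)
    (h : ∀ a : ℕ, ∃ y : mostlyAway I hreg n p, q ^ a • y = x) :
    x.1 ∈ smallSupport I hreg n := by
  refine ⟨x.2.1, ?_⟩
  choose y hy using h
  have hcount : CountableInterFilter (Filter.cocardinal I hreg) :=
    CardinalInterFilter.toCountableInterFilter _ hunc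
  filter_upwards [x.2.2, eventually_countable_forall.2 fun a => (y a).2.2] with i h1 h2
  refine eq_zero_of_forall_pow_mul_ratAway hq hqp h1 fun a => ⟨(y a).1 i, h2 a, ?_⟩
  rw [← hy a]
  simp

/-- The group `Z ⊕ ℤ[1/n] ⊕ ℤ⁽ᴶ⁾`. -/
abbrev TestGroup (n : ℕ) (Z : AddSubgroup (I → ℚ)) (J : Type u) : Type u :=
  Z × ratAway n × (J →₀ ℤ)

variable {n : ℕ} {Z : AddSubgroup (I → ℚ)} {J : Type u}

theorem eq_zero_of_mem_pOmega_testGroup {p : ℕ} (hp : 2 ≤ p) {x : TestGroup n Z J}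
    (hx : x ∈ pOmega p (TestGroup n Z J)) : x.2.2 = 0 := by
  rw [mem_pOmega] at hx
  ext j
  obtain ⟨y, hy⟩ := hx (x.2.2 j).natAbs
  refine Int.eq_zero_of_abs_lt_dvd (m := (p : ℤ) ^ (x.2.2 j).natAbs) ⟨y.2.2 j, ?_⟩ ?_
  · conv_lhs => rw [← hy]
    simp
  · rw [Int.abs_eq_natAbs]
    exact_mod_cast Nat.lt_pow_self hp

theorem mem_pOmega_testGroup {p : ℕ} (hp : 2 ≤ p) (hpn : p ∣ n) (hn : n ≠ 0)
    (hZ : ∀ (a : ℕ) (x : Z), ∃ y : Z, p ^ a • y = x) {x : TestGroup n Z J} :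
    x ∈ pOmega p (TestGroup n Z J) ↔ x.2.2 = 0 := by
  refine ⟨eq_zero_of_mem_pOmega_testGroup hp, fun h => mem_pOmega.2 fun a => ?_⟩
  obtain ⟨y, hy⟩ := hZ a x.1
  refine ⟨(y, ⟨x.2.1 / (p : ℚ) ^ a, div_pow_mem_ratAway hpn hn x.2.1.2 a⟩, 0), ?_⟩
  have hp0 : (p : ℚ) ≠ 0 := by positivity
  refine Prod.ext hy (Prod.ext (Subtype.ext ?_) ?_)
  · simp
    field_simp
  · simp [h]

theorem mk_pi_rat (hI : #I = μ) (hμ : ℵ₀ ≤ μ) : #(I → ℚ) = 2 ^ μ := by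
  have h : #(I → ℚ) = (#(ULift.{u} ℚ)) ^ #I := by
    rw [Cardinal.power_def]
    exact Cardinal.mk_congr (Equiv.arrowCongr (Equiv.refl I) Equiv.ulift.symm)
  rw [h, hI]
  refine Cardinal.power_eq_two_power hμ ?_ ?_
  · simp
  · simpa using hμ

theorem k2Mem_testGroup {p₁ p₂ : ℕ} (hp₁ : 2 ≤ p₁) (hp₂ : 2 ≤ p₂) (hI : #I = μ) (hμ : ℵ₀ ≤ μ) :
    K2Mem p₁ p₂ (2 ^ μ) (TestGroup n Z J) := by
  have hfun := mk_pi_rat hI hμ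
  have hcard : ∀ p, 2 ≤ p → #(pOmega p (TestGroup n Z J)) ≤ 2 ^ μ := by
    intro p hp
    have hinj : Function.Injective
        (fun x : pOmega p (TestGroup n Z J) => ((x.1.1 : I → ℚ), ULift.up.{u} (x.1.2.1 : ℚ))) := by
      intro x y hxy
      simp only [Prod.mk.injEq, ULift.up.injEq] at hxy
      refine Subtype.ext (Prod.ext (Subtype.ext hxy.1) (Prod.ext (Subtype.ext hxy.2) ?_))
      rw [eq_zero_of_mem_pOmega_testGroup hp x.2, eq_zero_of_mem_pOmega_testGroup hp y.2]
    refine (Cardinal.mk_le_of_injective hinj).trans ?_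
    have h2 : ℵ₀ ≤ (2 : Cardinal.{u}) ^ μ := hμ.trans (Cardinal.cantor μ).le
    rw [Cardinal.mk_prod, Cardinal.lift_id, Cardinal.lift_id, hfun]
    refine Cardinal.mul_le_of_le h2 le_rfl ?_
    simpa using h2
  exact ⟨inferInstance, hcard _ hp₁, hcard _ hp₂⟩

/-- The free summand serves only to reach the cardinality `θ`; it contributes nothing to `p^ω`. -/
theorem mk_testGroup (hI : #I = μ) (hμ : ℵ₀ ≤ μ) (hJ : 2 ^ μ ≤ #J) :
    #(TestGroup n Z J) = #J := by
  have h2 : ℵ₀ ≤ #J := (hμ.trans (Cardinal.cantor μ).le).trans hJ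
  have : Infinite J := Cardinal.infinite_iff.2 h2
  have hZ : #Z ≤ #J := (Cardinal.mk_le_of_injective Subtype.val_injective).trans
    ((mk_pi_rat hI hμ).le.trans hJ)
  have hF : #(J →₀ ℤ) = #J := by
    rw [Cardinal.mk_finsupp_lift_of_infinite]
    simp
  refine le_antisymm ?_ ?_
  · rw [Cardinal.mk_prod, Cardinal.lift_id, Cardinal.lift_id, Cardinal.mk_prod, Cardinal.lift_uzero,
      hF]
    refine Cardinal.mul_le_of_le h2 hZ (Cardinal.mul_le_of_le h2 ?_ le_rfl)
    refine le_trans ?_ h2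
    rw [Cardinal.lift_le_aleph0]
    exact Cardinal.mk_le_aleph0
  · rw [← hF]
    exact Cardinal.mk_le_of_injective (f := fun x : J →₀ ℤ => ((0, 0, x) : TestGroup n Z J))
      fun x y hxy => (Prod.mk.inj (Prod.mk.inj hxy).2).2

end TestGroups

/-! ### Embeddings and Galois types in `𝐊₂` -/

section Embeddings

variable {p₁ p₂ : ℕ} {κ : Cardinal.{u}} {G H : Type u} [AddCommGroup G] [AddCommGroup H]

theorem map_mem_pOmega {p : ℕ} (f : G →+ H) {x : G} (hx : x ∈ pOmega p G) :
    f x ∈ pOmega p H := by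
  rw [mem_pOmega] at hx ⊢
  intro n
  obtain ⟨y, hy⟩ := hx n
  exact ⟨f y, by rw [← map_nsmul, hy]⟩

theorem map_pOmega_addEquiv (p : ℕ) (e : G ≃+ H) :
    (pOmega p G).map e.toAddMonoidHom = pOmega p H := by
  ext x
  constructor
  · rintro ⟨y, hy, rfl⟩
    exact map_mem_pOmega e.toAddMonoidHom hy
  · intro hx
    exact ⟨e.symm x, map_mem_pOmega e.symm.toAddMonoidHom hx, e.apply_symm_apply x⟩

theorem pOmegaSub_range (p : ℕ) (f : G →+ H) (hf : Function.Injective f) :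
    pOmegaSub p f.range = (pOmega p G).map f := by
  rw [pOmegaSub, ← map_pOmega_addEquiv p (AddMonoidHom.ofInjective hf), AddSubgroup.map_map]
  rfl

theorem K2Mem.of_addEquiv (h : K2Mem p₁ p₂ κ G) (e : G ≃+ H) : K2Mem p₁ p₂ κ H := by
  have hcard : ∀ p, #(pOmega p H) = #(pOmega p G) := by
    intro p
    rw [← map_pOmega_addEquiv p e]
    exact (Cardinal.mk_congr
      ((pOmega p G).equivMapOfInjective e.toAddMonoidHom e.injective).toEquiv).symm
  obtain ⟨h0, h1, h2⟩ := h
  exact ⟨Function.Injective.isAddTorsionFree e.symm.toAddMonoidHom e.symm.injective,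
    (hcard p₁).trans_le h1, (hcard p₂).trans_le h2⟩

/-- Purity reduces to closure of the range under division by nonzero integers, and only one
inclusion between the `p^ω` subgroups needs checking. -/
theorem isEmbedding_K2 (hG : K2Mem p₁ p₂ κ G) (hH : K2Mem p₁ p₂ κ H) (f : G →+ H)
    (hf : Function.Injective f)
    (hpure : ∀ (n : ℤ) (y : H), n ≠ 0 → n • y ∈ f.range → y ∈ f.range)
    (h₁ : ∀ y ∈ pOmega p₁ H, ∃ x ∈ pOmega p₁ G, f x = y)
    (h₂ : pOmega p₂ G = pOmega p₁ G ∨ ∀ y ∈ pOmega p₂ H, ∃ x ∈ pOmega p₂ G, f x = y) :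
    (K2 p₁ p₂ κ).IsEmbedding f := by
  have hmap : ∀ p, (∀ y ∈ pOmega p H, ∃ x ∈ pOmega p G, f x = y) →
      pOmegaSub p f.range = pOmega p H := by
    intro p h
    rw [pOmegaSub_range p f hf]
    refine le_antisymm ?_ h
    rintro _ ⟨x, hx, rfl⟩
    exact map_mem_pOmega f hx
  refine ⟨hf, hG.of_addEquiv (AddMonoidHom.ofInjective hf), hH, fun n => ?_, hmap p₁ h₁, ?_⟩
  · ext x
    constructor
    · rintro ⟨g, hg, rfl⟩
      exact ⟨zsmul_mem hg n, g, rfl⟩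
    · rintro ⟨hx, h, rfl⟩
      rcases eq_or_ne n 0 with rfl | hn
      · exact ⟨0, zero_mem _, by simp⟩
      · exact ⟨h, hpure n h hn hx, rfl⟩
  · rcases h₂ with h | h
    · left
      rw [pOmegaSub_range _ f hf, pOmegaSub_range _ f hf, h]
    · exact Or.inr (hmap p₂ h)

theorem isEmbedding_K2_of_bijective (hG : K2Mem p₁ p₂ κ G) (f : G →+ G)
    (hf : Function.Bijective f) : (K2 p₁ p₂ κ).IsEmbedding f := by
  have hmap : ∀ p, ∀ y ∈ pOmega p G, ∃ x ∈ pOmega p G, f x = y := by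
    intro p y hy
    rw [← map_pOmega_addEquiv p (AddEquiv.ofBijective f hf)] at hy
    exact hy
  exact isEmbedding_K2 hG hG f hf.1 (fun n y _ _ => hf.2 y) (hmap p₁) (Or.inr (hmap p₂))

theorem K2_le_top (hG : K2Mem p₁ p₂ κ G) : (K2 p₁ p₂ κ).Le (⊤ : AddSubgroup G) := by
  have h := (isEmbedding_K2_of_bijective hG (AddMonoidHom.id G) Function.bijective_id).2
  rwa [AddMonoidHom.range_eq_top.2 Function.surjective_id] at h

theorem mem_pOmega_of_map_mem {p : ℕ} (f : G →+ H) (hf : Function.Injective f)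
    (hpure : IsPureSubgroup f.range) {x : G} (hx : f x ∈ pOmega p H) : x ∈ pOmega p G := by
  rw [mem_pOmega] at hx ⊢
  intro n
  obtain ⟨h, hh⟩ := hx n
  have hmem : f x ∈ {y : H | ∃ g ∈ f.range, ((p ^ n : ℕ) : ℤ) • g = y} := by
    rw [hpure]
    exact ⟨⟨x, rfl⟩, h, by rw [natCast_zsmul, hh]⟩
  obtain ⟨_, ⟨g, rfl⟩, hg⟩ := hmem
  refine ⟨g, hf ?_⟩
  rw [← hg, natCast_zsmul, map_nsmul]

end Embeddings

/-! ### An invariant of Galois types. -/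

section Types

open GroupClass

variable {p₁ p₂ : ℕ} {κ : Cardinal.{u}} {A : Type u}

/-- If `b ∈ p₂^ω ∖ p₁^ω`, then both properties are preserved by `E`, and `E`-equivalence yields a
hom between the groups `p₂^ω` that respects the parameters and the distinguished elements. -/
theorem exists_hom_pOmega_of_E {s t : Triple (K2 p₁ p₂ κ) A} (h : E s t)
    (hs₂ : s.b ∈ pOmega p₂ s.N) (hs₁ : s.b ∉ pOmega p₁ s.N) :
    t.b ∈ pOmega p₂ t.N ∧ t.b ∉ pOmega p₁ t.N ∧
      ∃ φ : pOmega p₂ s.N →+ pOmega p₂ t.N, (φ ⟨s.b, hs₂⟩ : t.N) = t.b ∧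
        ∀ a (ha : s.incl a ∈ pOmega p₂ s.N), (φ ⟨s.incl a, ha⟩ : t.N) = t.incl a := by
  have step : ∀ {s t : Triple (K2 p₁ p₂ κ) A}, EAt s t →
      ∀ (hs₂ : s.b ∈ pOmega p₂ s.N) (_ : s.b ∉ pOmega p₁ s.N),
      t.b ∈ pOmega p₂ t.N ∧ t.b ∉ pOmega p₁ t.N ∧
      ∃ φ : pOmega p₂ s.N →+ pOmega p₂ t.N, (φ ⟨s.b, hs₂⟩ : t.N) = t.b ∧
        ∀ a (ha : s.incl a ∈ pOmega p₂ s.N), (φ ⟨s.incl a, ha⟩ : t.N) = t.incl a := by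
    rintro s t ⟨N, _, f, g, -, ⟨hf, -, -, -, hf₁, -⟩, ⟨hg, -, -, hpure, -, hg₂⟩, hA, hb⟩ hs₂ hs₁
    have ht₂ : t.b ∈ pOmega p₂ t.N :=
      mem_pOmega_of_map_mem g hg hpure (hb ▸ map_mem_pOmega f hs₂)
    have ht₁ : t.b ∉ pOmega p₁ t.N := by
      intro h
      have hmem : f s.b ∈ pOmega p₁ N := hb ▸ map_mem_pOmega g h
      rw [← hf₁, pOmegaSub_range p₁ f hf] at hmem
      obtain ⟨x, hx, hxb⟩ := hmem
      exact hs₁ (hf hxb ▸ hx)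
    have hg₂' : (pOmega p₂ t.N).map g = pOmega p₂ N := by
      rw [pOmegaSub_range _ g hg, pOmegaSub_range _ g hg] at hg₂
      -- Under the first alternative `g t.b` would lie in the image of `p₁^ω`, contrary to `ht₁`.
      refine hg₂.resolve_left fun h => ht₁ ?_
      have hmem : g t.b ∈ (pOmega p₂ t.N).map g := ⟨_, ht₂, rfl⟩
      rw [h] at hmem
      obtain ⟨x, hx, hxb⟩ := hmem
      exact hg hxb ▸ hx
    -- Now `f` carries `p₂^ω` into the image of `p₂^ω` under `g`, so `φ = g⁻¹ ∘ f` makes sense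
    -- there.
    have hlift : ∀ x : pOmega p₂ s.N, ∃ y : pOmega p₂ t.N, g y = f x := by
      intro x
      have hmem : f x ∈ pOmega p₂ N := map_mem_pOmega f x.2
      rw [← hg₂'] at hmem
      obtain ⟨y, hy, hyx⟩ := hmem
      exact ⟨⟨y, hy⟩, hyx⟩
    choose φ hφ using hlift
    refine ⟨ht₂, ht₁, AddMonoidHom.mk' φ fun x y => Subtype.ext (hg ?_), hg ?_,
      fun a ha => hg ?_⟩
    · rw [hφ, AddSubgroup.coe_add, map_add, ← hφ, ← hφ, ← map_add, AddSubgroup.coe_add]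
    · exact (hφ _).trans hb
    · exact (hφ _).trans (hA a)
  induction h with
  | single h => exact step h hs₂ hs₁
  | tail _ h ih =>
    obtain ⟨h₂, h₁, φ, hφb, hφA⟩ := ih
    obtain ⟨k₂, k₁, ψ, hψb, hψA⟩ := step h h₂ h₁
    refine ⟨k₂, k₁, ψ.comp φ, ?_, fun a ha => ?_⟩
    · have : φ ⟨s.b, hs₂⟩ = ⟨_, h₂⟩ := Subtype.ext hφb
      rw [AddMonoidHom.comp_apply, this, hψb]
    · have hmem := (φ ⟨s.incl a, ha⟩).2
      rw [hφA a ha] at hmem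
      have : φ ⟨s.incl a, ha⟩ = ⟨_, hmem⟩ := Subtype.ext (hφA a ha)
      rw [AddMonoidHom.comp_apply, this, hψA]

end Types

/-! ### The extension of `M` by `N`, and the obstruction over `M`. -/

section Counterexample

open GroupClass

/-- The shear `(z, t, j) ↦ (z, t + l z, j)`. -/
def shear {Z R F : Type*} [AddCommGroup Z] [AddCommGroup R] [AddCommGroup F] (l : Z →+ R) :
    Z × R × F →+ Z × R × F :=
  AddMonoidHom.mk' (fun x => (x.1, x.2.1 + l x.1, x.2.2)) fun x y => by
    refine Prod.ext rfl (Prod.ext ?_ rfl)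
    simp only [Prod.fst_add, Prod.snd_add, map_add]
    abel

theorem shear_apply {Z R F : Type*} [AddCommGroup Z] [AddCommGroup R] [AddCommGroup F]
    (l : Z →+ R) (x : Z × R × F) : shear l x = (x.1, x.2.1 + l x.1, x.2.2) := rfl

theorem shear_bijective {Z R F : Type*} [AddCommGroup Z] [AddCommGroup R] [AddCommGroup F]
    (l : Z →+ R) : Function.Bijective (shear (F := F) l) := by
  refine Function.bijective_iff_has_inverse.2 ⟨shear (-l), fun x => ?_, fun x => ?_⟩ <;>
    simp [shear_apply]

variable {I J : Type u} {μ : Cardinal.{u}}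

/-- The inclusion `TestGroup n (smallSupport I hreg n) J → TestGroup n (mostlyAway I hreg n p) J`. -/
noncomputable def testInclusion (J : Type u) (hreg : μ.IsRegular) (n p : ℕ) :
    TestGroup n (smallSupport I hreg n) J →+ TestGroup n (mostlyAway I hreg n p) J :=
  AddMonoidHom.prodMap (AddSubgroup.inclusion (smallSupport_le_mostlyAway hreg n p))
    (AddMonoidHom.id _)

theorem mem_range_testInclusion {hreg : μ.IsRegular} {n p : ℕ}
    {y : TestGroup n (mostlyAway I hreg n p) J} :
    y ∈ (testInclusion J hreg n p).range ↔
      ∀ᶠ i in Filter.cocardinal I hreg, y.1.1 i = 0 := by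
  constructor
  · rintro ⟨x, rfl⟩
    exact x.1.2.2
  · intro h
    exact ⟨(⟨y.1.1, y.1.2.1, h⟩, y.2), rfl⟩

theorem testInclusion_injective (hreg : μ.IsRegular) (n p : ℕ) :
    Function.Injective (testInclusion (I := I) J hreg n p) := by
  intro x y hxy
  have h1 : x.1.1 = y.1.1 := congrArg (fun z => z.1.1) hxy
  have h2 : x.2 = y.2 :=
    congrArg (fun z : TestGroup n (mostlyAway I hreg n p) J => z.2) hxy
  exact Prod.ext (Subtype.ext h1) h2

variable {p₁ p₂ : ℕ}

theorem isEmbedding_testInclusion (hp₁ : p₁.Prime) (hp₂ : p₂.Prime) (hp : p₁ ≠ p₂)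
    (hreg : μ.IsRegular) (hunc : ℵ₀ < μ) (hI : #I = μ) :
    (K2 p₁ p₂ (2 ^ μ)).IsEmbedding (testInclusion (I := I) J hreg (p₁ * p₂) p₂) := by
  have hn : p₁ * p₂ ≠ 0 := mul_ne_zero hp₁.ne_zero hp₂.ne_zero
  refine isEmbedding_K2 (k2Mem_testGroup hp₁.two_le hp₂.two_le hI hunc.le)
    (k2Mem_testGroup hp₁.two_le hp₂.two_le hI hunc.le) _ (testInclusion_injective _ _ _) ?_ ?_ ?_
  · intro n y hn hy
    rw [mem_range_testInclusion] at hy ⊢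
    filter_upwards [hy] with i hi
    have : (n : ℚ) * y.1.1 i = 0 := by simpa using hi
    exact (mul_eq_zero.1 this).resolve_left (by exact_mod_cast hn)
  · intro y hy
    have hsmall : y.1.1 ∈ smallSupport I hreg (p₁ * p₂) := by
      refine mem_smallSupport_of_forall_pow_smul hreg hunc hp₁
        (fun h => hp ((Nat.prime_dvd_prime_iff_eq hp₁ hp₂).1 h)) y.1 fun a => ?_
      obtain ⟨z, hz⟩ := mem_pOmega.1 hy a
      exact ⟨z.1, congrArg Prod.fst hz⟩
    refine ⟨(⟨y.1.1, hsmall⟩, y.2), ?_, rfl⟩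
    rw [mem_pOmega_testGroup hp₁.two_le (Dvd.intro _ rfl) hn
      fun a x => exists_pow_smul_eq_smallSupport hreg (Dvd.intro _ rfl) hn a x]
    exact (eq_zero_of_mem_pOmega_testGroup hp₁.two_le hy : y.2.2 = 0)
  -- In the smaller group both `p^ω` subgroups are the kernel of the projection to `J →₀ ℤ`.
  · left
    ext x
    rw [mem_pOmega_testGroup hp₁.two_le (Dvd.intro _ rfl) hn
      fun a x => exists_pow_smul_eq_smallSupport hreg (Dvd.intro _ rfl) hn a x,
      mem_pOmega_testGroup hp₂.two_le (Dvd.intro_left _ rfl) hn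
      fun a x => exists_pow_smul_eq_smallSupport hreg (Dvd.intro_left _ rfl) hn a x]

/-- The hom `ℤ ^ I → mostlyAway I hreg n p`. -/
def intFunction (hreg : μ.IsRegular) (n p : ℕ) : (I → ℤ) →+ mostlyAway I hreg n p :=
  AddMonoidHom.mk' (fun x => ⟨fun i => x i, fun i => intCast_mem_ratAway _ _,
    Filter.Eventually.of_forall fun i => intCast_mem_ratAway _ _⟩) fun x y => by
      ext i
      simp

/-- The evaluation at `i`. -/
def evalAway (hreg : μ.IsRegular) (n p : ℕ) (i : I) : mostlyAway I hreg n p →+ ratAway n :=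
  AddMonoidHom.mk' (fun x => ⟨x.1 i, x.2.1 i⟩) fun _ _ => rfl

/-- A hom on `mostlyAway ⊕ ℤ[1/n] ⊕ 0` that fixes all elements with small support cannot send
`(1, 0, 0)` to `(1, 1, 0)` when every countably complete ultrafilter on `I` is principal. -/
theorem not_exists_hom_pOmega (hp₁ : p₁.Prime) (hp₂ : p₂.Prime) (hreg : μ.IsRegular)
    (hI : ∀ U : Ultrafilter I, CountableInterFilter (U : Filter I) → ∃ i, U = pure i)
    (φ : pOmega p₂ (TestGroup (p₁ * p₂) (mostlyAway I hreg (p₁ * p₂) p₂) J) →+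
      pOmega p₂ (TestGroup (p₁ * p₂) (mostlyAway I hreg (p₁ * p₂) p₂) J))
    (hfix : ∀ x : pOmega p₂ (TestGroup (p₁ * p₂) (mostlyAway I hreg (p₁ * p₂) p₂) J),
      x.1 ∈ (testInclusion J hreg (p₁ * p₂) p₂).range → φ x = x)
    (h : ∀ x, x.1 = (intFunction hreg _ _ 1, 0, 0) → (φ x).1.2.1 ≠ 0) : False := by
  classical
  have hn : p₁ * p₂ ≠ 0 := mul_ne_zero hp₁.ne_zero hp₂.ne_zero
  have hmem : ∀ x : I → ℤ, (intFunction hreg (p₁ * p₂) p₂ x, 0, 0) ∈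
      pOmega p₂ (TestGroup (p₁ * p₂) (mostlyAway I hreg (p₁ * p₂) p₂) J) := by
    intro x
    rw [mem_pOmega_testGroup hp₂.two_le (Dvd.intro_left _ rfl) hn
      fun a x => exists_pow_smul_eq_mostlyAway hreg (Dvd.intro_left _ rfl) hn a x]
  let g : (I → ℤ) →+ ratAway (p₁ * p₂) :=
    AddMonoidHom.mk' (fun x => (φ ⟨_, hmem x⟩).1.2.1) fun x y => by
      have : (⟨_, hmem (x + y)⟩ : pOmega p₂ _) = ⟨_, hmem x⟩ + ⟨_, hmem y⟩ := by
        refine Subtype.ext (Prod.ext (map_add _ _ _) (Prod.ext ?_ ?_)) <;> simp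
      rw [this, map_add]
      rfl
  refine h ⟨_, hmem 1⟩ rfl (map_one_eq_zero_of_map_single
    (fun a ha => exists_zsmul_ne_of_ratAway hn a ha) hI g fun i => ?_)
  have hr : (intFunction hreg (p₁ * p₂) p₂ (Pi.single i 1), 0, 0) ∈
      (testInclusion J hreg (p₁ * p₂) p₂).range := by
    rw [mem_range_testInclusion]
    filter_upwards [Filter.eventually_cocardinal_ne i] with j hj
    simp [intFunction, hj]
  change (φ _).1.2.1 = 0
  rw [hfix ⟨_, hmem _⟩ hr]

end Counterexample

theorem lemma4p13 (p₁ p₂ : ℕ) (hp₁ : p₁.Prime) (hp₂ : p₂.Prime) (hp : p₁ ≠ p₂)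
    (μ : Cardinal.{u}) (hreg : μ.IsRegular) (hunc : ℵ₀ < μ)
    (hmeas : ∀ κ : Cardinal.{u}, IsMeasurableCardinal κ → μ < κ)
    (θ : Cardinal.{u}) (hθ : 2 ^ μ ≤ θ) :
    ¬ (K2 p₁ p₂ (2 ^ μ)).IsTame μ θ := by
  intro htame
  obtain ⟨I, hI⟩ : ∃ I : Type u, #I = μ := ⟨μ.out, μ.mk_out⟩
  obtain ⟨J, hJ⟩ : ∃ J : Type u, #J = θ := ⟨θ.out, θ.mk_out⟩
  have hultra : ∀ U : Ultrafilter I, CountableInterFilter (U : Filter I) → ∃ i, U = pure i := by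
    intro U hU
    by_contra! hpure
    obtain ⟨κ, hκ, hle⟩ := exists_isMeasurableCardinal_le U hU hpure
    exact absurd (hmeas κ hκ) (not_lt.2 (hI ▸ hle))
  have hn : p₁ * p₂ ≠ 0 := mul_ne_zero hp₁.ne_zero hp₂.ne_zero
  let M := TestGroup (p₁ * p₂) (smallSupport I hreg (p₁ * p₂)) J
  let N := TestGroup (p₁ * p₂) (mostlyAway I hreg (p₁ * p₂) p₂) J
  have hM : K2Mem p₁ p₂ (2 ^ μ) M := k2Mem_testGroup hp₁.two_le hp₂.two_le hI hunc.le
  have hN : K2Mem p₁ p₂ (2 ^ μ) N := k2Mem_testGroup hp₁.two_le hp₂.two_le hI hunc.le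
  have hf := isEmbedding_testInclusion (J := J) hp₁ hp₂ hp hreg hunc hI
  let e : ratAway (p₁ * p₂) := ⟨1, by simpa using intCast_mem_ratAway (p₁ * p₂) 1⟩
  let b : ratAway (p₁ * p₂) → N := fun c => (intFunction hreg _ _ 1, c, 0)
  let t : ratAway (p₁ * p₂) → GroupClass.Triple (K2 p₁ p₂ (2 ^ μ)) M := fun c =>
    ⟨N, hN, ⟨testInclusion J hreg _ _, hf.1⟩, b c⟩
  have hgS : ∀ c, GroupClass.gtp (t c) ∈ (K2 p₁ p₂ (2 ^ μ)).gS M := fun c =>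
    ⟨N, inferInstance, hN, _, hf, b c, rfl⟩
  have hid := isEmbedding_K2_of_bijective hN (AddMonoidHom.id N) Function.bijective_id
  have hsmall : ∀ s : Set I, #s < μ → ∃ i, i ∉ s := by
    intro s hs
    by_contra! hall
    rw [Set.eq_univ_of_forall hall, Cardinal.mk_univ, hI] at hs
    exact hs.false
  have hne : GroupClass.gtp (t 0) ≠ GroupClass.gtp (t e) := by
    intro heq
    have hE : GroupClass.E (t 0) (t e) := by
      have : t e ∈ GroupClass.gtp (t e) := Relation.TransGen.single
        ⟨N, inferInstance, AddMonoidHom.id N, AddMonoidHom.id N, hN, hid, hid, fun _ => rfl, rfl⟩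
      rwa [← heq] at this
    have hb₂ : b 0 ∈ pOmega p₂ N :=
      (mem_pOmega_testGroup hp₂.two_le (Dvd.intro_left _ rfl) hn
        fun a x => exists_pow_smul_eq_mostlyAway hreg (Dvd.intro_left _ rfl) hn a x).2 rfl
    have hb₁ : b 0 ∉ pOmega p₁ N := by
      intro h
      -- Since `p₁^ω N` lies in the image of `M`, the constant function `1` would have small
      -- support.
      rw [← hf.2.2.2.2.1, pOmegaSub_range _ _ hf.1] at h
      obtain ⟨x, -, hx⟩ := h
      have hev := mem_range_testInclusion.1 ⟨x, hx⟩
      obtain ⟨i, hi⟩ := hsmall _ hev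
      simp [b, intFunction] at hi
    obtain ⟨-, -, φ, hφb, hφ⟩ := exists_hom_pOmega_of_E hE hb₂ hb₁
    refine not_exists_hom_pOmega hp₁ hp₂ hreg hultra φ ?_ ?_
    · rintro ⟨_, hx⟩ ⟨x, rfl⟩
      exact Subtype.ext (hφ x hx)
    · rintro ⟨_, hx⟩ rfl h0
      have h1 : (φ ⟨b 0, hb₂⟩).1.2.1 = e := congrArg (fun z : N => z.2.1) hφb
      have h2 : e = 0 := h1.symm.trans h0
      simpa [e] using congrArg Subtype.val h2
  obtain ⟨B, hB, hBne⟩ := htame M hM ((mk_testGroup hI hunc.le (hJ ▸ hθ)).trans hJ)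
    _ (hgS 0) _ (hgS e) hne
  refine hBne ?_
  have hrefl : ∀ (H : Type u) [AddCommGroup H], (K2 p₁ p₂ (2 ^ μ)).Mem H →
      (K2 p₁ p₂ (2 ^ μ)).Le (⊤ : AddSubgroup H) := fun H _ hH => K2_le_top hH
  rw [GroupClass.restrictType_gtp hrefl, GroupClass.restrictType_gtp hrefl]
  -- Regularity of `μ`: fewer than `μ` supports, each of size less than `μ`, do not cover `I`.
  have hev : ∀ᶠ i in Filter.cocardinal I hreg, ∀ x : B, x.1.1.1 i = 0 :=
    (Filter.eventually_cardinal_forall hB).2 fun x => x.1.1.2.2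
  obtain ⟨i, hi⟩ := hsmall _ hev
  have hi : ∀ x : B, x.1.1.1 i = 0 := not_not.1 hi
  have hF := isEmbedding_K2_of_bijective hN _ (shear_bijective (evalAway hreg (p₁ * p₂) p₂ i))
  have hfix : ∀ a : B, shear (evalAway hreg (p₁ * p₂) p₂ i) (testInclusion J hreg _ _ a.1) =
      testInclusion J hreg _ _ a.1 := by
    intro a
    rw [shear_apply]
    refine Prod.ext rfl (Prod.ext ?_ rfl)
    refine Subtype.ext ?_
    change (a.1.2.1 : ℚ) + a.1.1.1 i = a.1.2.1
    rw [hi a, add_zero]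
  have hmove : shear (evalAway hreg (p₁ * p₂) p₂ i) (b 0) = b e := by
    rw [shear_apply]
    refine Prod.ext rfl (Prod.ext ?_ rfl)
    refine Subtype.ext ?_
    simp [b, e, evalAway, intFunction]
  have h1 : GroupClass.E ((t 0).restrict B) ((t e).restrict B) := Relation.TransGen.single
    ⟨N, inferInstance, _, AddMonoidHom.id N, hN, hF, hid, hfix, hmove⟩
  have h2 : GroupClass.E ((t e).restrict B) ((t 0).restrict B) := Relation.TransGen.single
    ⟨N, inferInstance, AddMonoidHom.id N, _, hN, hid, hF, fun a => (hfix a).symm, hmove.symm⟩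
  ext s
  exact ⟨fun hs => Relation.TransGen.trans h2 hs, fun hs => Relation.TransGen.trans h1 hs⟩
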